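/- Let $L\ge 1$, $\rho>0$, $\zeta>0$ and $\delta\in\mathbb R$. Let the fading amplitudes $|h_1|,\dots,|h_L|$ be random variables, where $|h_l|$ has the log-logistic law with scale $\alpha'_l>0$ and shape $\beta'_l>0$, that is, $\Pr(|h_l|\le x)=\bigl(1+(x/\alpha'_l)^{-\beta'_l}\bigr)^{-1}$ for $x>0$ and $\Pr(|h_l|\le x)=0$ for $x\le 0$. Put $\alpha_l=(\alpha'_l)^2$, $\beta_l=\beta'_l/2$, and let $\gamma_l=\rho|h_l|^2$ be the signal-to-noise ratio of the $l$-th branch. Assume that $\gamma_1,\dots,\gamma_L$ are independent (not necessarily identically distributed), and let $\gamma_{SC}=\max\{\gamma_1,\dots,\gamma_L\}$ be the output of the selection combining receiver. Then $\gamma_{SC}$ has a probability density $f_{\gamma_{SC}}$, and its average bit error rate $$\overline{P_e}=\int_0^\infty \delta\,\operatorname{erfc}\bigl(\sqrt{\zeta\gamma}\bigr)\,f_{\gamma_{SC}}(\gamma)\,d\gamma$$ is given, both this integral and the one defining the H-function being absolutely convergent, by $$\overline{P_e}=\frac{\delta}{\sqrt{\pi}}\;H^{0,1:1,1;\dots;1,1}_{1,0:1,1;\dots;1,1}\left[\begin{matrix}(\zeta\rho\alpha_1)^{-\beta_1}\\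 \vdots\\ (\zeta\rho\alpha_L)^{-\beta_L}\end{matrix}\;\middle|\;\begin{matrix}(\tfrac12;\beta_1,\dots,\beta_L):(1,1);\dots;(1,1)\\ -:(1,1);\dots;(1,1)\end{matrix}\right].$$ Here the multivariate Fox H-function with these parameters is the Mellin–Barnes integral $$H[z_1,\dots,z_L]=\frac1{(2\pi i)^L}\int_{c_1-i\infty}^{c_1+i\infty}\!\!\cdots\int_{c_L-i\infty}^{c_L+i\infty}\Gamma\Bigl(\tfrac12+\sum_{l=1}^L\beta_l s_l\Bigr)\prod_{l=1}^L\Gamma(s_l)\,\Gamma(1-s_l)\,z_l^{s_l}\;ds_1\cdots ds_L ,$$ in which the lines $\operatorname{Re}s_l=c_l$ separate the poles of $\Gamma(1-s_l)$ from those of $\Gamma(s_l)$ and of $\Gamma(\tfrac12+\sum_l\beta_l s_l)$, i.e. $0<c_l<1$ for every $l$; the value does not depend on the choice of such $c_1,\dots,c_L$. -/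

import Mathlib

open MeasureTheory ProbabilityTheory

noncomputable section

/-! ### The complementary error function -/

/-- The complementary error function `erfc x = (2 / √π) ∫_x^∞ exp (-t²) dt`. -/
def erfc (x : ℝ) : ℝ :=
  2 / Real.sqrt Real.pi * ∫ t in Set.Ioi x, Real.exp (-t ^ 2)

/-! ### Log-logistic random variables -/

/-- The distribution function of the log-logistic law with scale `a` and shape `b`. The case `x ≤ 0`
is separate because `(0 : ℝ) ^ (-b) = 0` in Lean, where the limit `+∞` is meant. -/
def logLogisticCDF (a b x : ℝ) : ℝ :=
  if 0 < x then 1 / (1 + (x / a) ^ (-b)) else 0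

/-- `X` is a real random variable with the log-logistic law of scale `a` and shape `b`. -/
def IsLogLogistic {Ω : Type*} [MeasurableSpace Ω] (X : Ω → ℝ) (a b : ℝ) (P : Measure Ω) : Prop :=
  0 < a ∧ 0 < b ∧ AEMeasurable X P ∧ ∀ x : ℝ, cdf (P.map X) x = logLogisticCDF a b x

/-! ### The selection combining receiver -/

/-- Instantaneous signal-to-noise ratio `γ_l = ρ |h_l|²` of the `l`-th branch. -/
def branchSNR {Ω : Type*} {L : ℕ} (ρ : ℝ) (h : Fin L → Ω → ℂ) (l : Fin L) (ω : Ω) : ℝ :=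
  ρ * ‖h l ω‖ ^ 2

/-- Output signal-to-noise ratio `γ_SC = max {γ_1, …, γ_L}`. -/
def scSNR {Ω : Type*} {L : ℕ} (ρ : ℝ) (h : Fin L → Ω → ℂ) (ω : Ω) : ℝ :=
  ⨆ l : Fin L, branchSNR ρ h l ω

/-- The integrand `γ ↦ δ erfc (√(ζ γ)) f_X(γ)` of the average bit error rate, `f_X` being the
Lebesgue density of `X`. -/
def berIntegrand {Ω : Type*} [MeasurableSpace Ω] (P : Measure Ω) (X : Ω → ℝ) (δ ζ : ℝ)
    (x : ℝ) : ℝ :=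
  δ * erfc (Real.sqrt (ζ * x)) * (pdf X P volume x).toReal

/-- The average bit error rate `∫_0^∞ δ erfc (√(ζ γ)) f_X(γ) dγ`. -/
def averageBER {Ω : Type*} [MeasurableSpace Ω] (P : Measure Ω) (X : Ω → ℝ) (δ ζ : ℝ) : ℝ :=
  ∫ x in Set.Ioi (0 : ℝ), berIntegrand P X δ ζ x

/-! ### The multivariate Fox H-function -/

/-- The orders and parameters of the `r`-variate Fox H-function
`H^{0,n : m_1,n_1; …; m_r,n_r}_{p,q : p_1,q_1; …; p_r,q_r}` with
shared upper parameters `(a_j; A_j^{(1)}, …, A_j^{(r)})`, `j = 1, …, p`,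
shared lower parameters `(b_j; B_j^{(1)}, …, B_j^{(r)})`, `j = 1, …, q`, and, in the `i`-th variable,
upper parameters `(c_j^{(i)}, C_j^{(i)})`, `j = 1, …, p_i`,
and lower parameters `(d_j^{(i)}, D_j^{(i)})`, `j = 1, …, q_i`. -/
structure FoxHParams (r : ℕ) where
  n : ℕ
  p : ℕ
  q : ℕ
  a : Fin p → ℂ
  A : Fin p → Fin r → ℝ
  b : Fin q → ℂ
  B : Fin q → Fin r → ℝ
  mv : Fin r → ℕ
  nv : Fin r → ℕ
  pv : Fin r → ℕ
  qv : Fin r → ℕ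
  c : (i : Fin r) → Fin (pv i) → ℂ
  C : (i : Fin r) → Fin (pv i) → ℝ
  d : (i : Fin r) → Fin (qv i) → ℂ
  D : (i : Fin r) → Fin (qv i) → ℝ

namespace FoxHParams

variable {r : ℕ} (H : FoxHParams r)

/-- The orders are in range and all coefficients of the variables are positive. -/
structure WellFormed : Prop where
  n_le : H.n ≤ H.p
  mv_le : ∀ i, H.mv i ≤ H.qv i
  nv_le : ∀ i, H.nv i ≤ H.pv i
  A_pos : ∀ j i, 0 < H.A j i
  B_pos : ∀ j i, 0 < H.B j i
  C_pos : ∀ i j, 0 < H.C i j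
  D_pos : ∀ i j, 0 < H.D i j

/-- The joint factor
`Ψ(s) = ∏_{j ≤ n} Γ(1 - a_j + ∑ A_j s) / (∏_{n < j ≤ p} Γ(a_j - ∑ A_j s) ∏_j Γ(1 - b_j + ∑ B_j s))`.
-/
def psi (s : Fin r → ℂ) : ℂ :=
  (∏ j : Fin H.p,
    if (j : ℕ) < H.n then Complex.Gamma (1 - H.a j + ∑ i, (H.A j i : ℂ) * s i)
    else (Complex.Gamma (H.a j - ∑ i, (H.A j i : ℂ) * s i))⁻¹) *
  ∏ j : Fin H.q, (Complex.Gamma (1 - H.b j + ∑ i, (H.B j i : ℂ) * s i))⁻¹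

/-- The factor of the `i`-th variable,
`φ_i(s) = ∏_{j ≤ n_i} Γ(1 - c_j + C_j s) ∏_{j ≤ m_i} Γ(d_j - D_j s)
  / (∏_{n_i < j ≤ p_i} Γ(c_j - C_j s) ∏_{m_i < j ≤ q_i} Γ(1 - d_j + D_j s))`. -/
def phi (i : Fin r) (s : ℂ) : ℂ :=
  (∏ j : Fin (H.pv i),
    if (j : ℕ) < H.nv i then Complex.Gamma (1 - H.c i j + (H.C i j : ℂ) * s)
    else (Complex.Gamma (H.c i j - (H.C i j : ℂ) * s))⁻¹) *
  ∏ j : Fin (H.qv i),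
    if (j : ℕ) < H.mv i then Complex.Gamma (H.d i j - (H.D i j : ℂ) * s)
    else (Complex.Gamma (1 - H.d i j + (H.D i j : ℂ) * s))⁻¹

/-- The Mellin–Barnes integrand `Ψ(s_1, …, s_r) ∏_i φ_i(s_i) z_i ^ {s_i}`. -/
def integrand (z s : Fin r → ℂ) : ℂ :=
  H.psi s * ∏ i, H.phi i (s i) * z i ^ s i

/-- The point `x_i + √-1 t_i`, `i = 1, …, r`, of the product of the vertical lines `Re s_i = x_i`. -/
def linePoint (x t : Fin r → ℝ) (i : Fin r) : ℂ :=
  (x i : ℂ) + (t i : ℂ) * Complex.I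

/-- The vertical lines `Re s_i = x_i` separate the poles: those of `Γ(d_j - D_j s_i)`, `j ≤ m_i`, lie
to the right, those of `Γ(1 - c_j + C_j s_i)`, `j ≤ n_i`, and of `Γ(1 - a_j + ∑ A_j s)`, `j ≤ n`, to
the left. -/
structure Separates (x : Fin r → ℝ) : Prop where
  left : ∀ j : Fin H.p, (j : ℕ) < H.n → 0 < (1 - H.a j).re + ∑ i, H.A j i * x i
  left_i : ∀ i, ∀ j : Fin (H.pv i), (j : ℕ) < H.nv i → 0 < (1 - H.c i j).re + H.C i j * x i
  right_i : ∀ i, ∀ j : Fin (H.qv i), (j : ℕ) < H.mv i → 0 < (H.d i j).re - H.D i j * x i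

/-- The Mellin–Barnes integral `(2π√-1)^{-r} ∫ ⋯ ∫ Ψ(s) ∏_i φ_i(s_i) z_i ^ {s_i} ds_1 ⋯ ds_r` over
the upward vertical lines `Re s_i = x_i`; on these, `ds_i = √-1 dt_i`. -/
def mellinBarnes (z : Fin r → ℂ) (x : Fin r → ℝ) : ℂ :=
  (1 / (2 * (Real.pi : ℂ) * Complex.I)) ^ r *
    ∫ t : Fin r → ℝ, H.integrand z (linePoint x t) * Complex.I ^ r

/-- `w` is the value at `z` of the multivariate Fox H-function: vertical lines separating the poles
exist, and over all such lines the Mellin–Barnes integral converges absolutely and equals `w`.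
(Contours with indentations are not needed for parameters for which such lines exist.) -/
structure HasValue (z : Fin r → ℂ) (w : ℂ) : Prop where
  wellFormed : H.WellFormed
  ne_zero : ∀ i, z i ≠ 0
  exists_separates : ∃ x : Fin r → ℝ, H.Separates x
  integrable : ∀ x, H.Separates x →
    Integrable (fun t : Fin r → ℝ => H.integrand z (linePoint x t))
  eq_value : ∀ x, H.Separates x → H.mellinBarnes z x = w

open Classical in
/-- The value at `z` of the multivariate Fox H-function (`0` when it is not defined). -/
def foxH (z : Fin r → ℂ) : ℂ :=
  if h : ∃ w, H.HasValue z w then h.choose else 0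

end FoxHParams

/-- The parameters `H^{0,1 : 1,1; …; 1,1}_{1,0 : 1,1; …; 1,1}` with shared upper parameter
`(1/2; β_1, …, β_L)`, no shared lower parameter, and upper and lower parameter `(1, 1)` in each
variable. -/
def berFoxHParams {L : ℕ} (β : Fin L → ℝ) : FoxHParams L where
  n := 1
  p := 1
  q := 0
  a := fun _ => 1 / 2
  A := fun _ => β
  b := fun _ => 0
  B := fun _ _ => 0
  mv := fun _ => 1
  nv := fun _ => 1
  pv := fun _ => 1
  qv := fun _ => 1
  c := fun _ _ => 1
  C := fun _ _ => 1
  d := fun _ _ => 1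
  D := fun _ _ => 1

end

/-! ### Decay of Γ(s)Γ(1-s) on vertical lines -/

theorem Real.one_add_sq_div_two_le_cosh (x : ℝ) : 1 + x ^ 2 / 2 ≤ Real.cosh x := by
  have h : ∀ u : ℝ, 0 ≤ u → 1 + u ^ 2 / 2 ≤ Real.cosh u := fun u hu => by
    have h1 : u / 2 ≤ Real.sinh (u / 2) := Real.self_le_sinh_iff.2 (by positivity)
    have h2 := Real.cosh_two_mul (u / 2)
    rw [Real.cosh_sq, mul_div_cancel₀ u two_ne_zero] at h2
    nlinarith
  simpa using h |x| (abs_nonneg x)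

theorem Complex.norm_sin_ge_sin_re_mul_cosh_im (a b : ℝ) :
    Real.sin a * Real.cosh b ≤ ‖Complex.sin (a + b * Complex.I)‖ := by
  rw [Complex.sin_add_mul_I]
  refine le_trans (le_of_eq ?_) (Complex.re_le_norm _)
  rw [← Complex.ofReal_sin, ← Complex.ofReal_cos, ← Complex.ofReal_cosh, ← Complex.ofReal_sinh]
  simp [Real.sin]

/-- By reflection the product is π / sin(πs), and |sin(πs)| is at least its real part sin(πc)
cosh(πt). The decay is exponential; a quadratic bound suffices for integrability. -/
theorem Complex.norm_Gamma_mul_Gamma_one_sub_le {c : ℝ} (h0 : 0 < c) (h1 : c < 1) (t : ℝ) :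
    ‖Complex.Gamma (c + t * Complex.I) * Complex.Gamma (1 - (c + t * Complex.I))‖ ≤
      Real.pi / Real.sin (Real.pi * c) * (1 + t ^ 2)⁻¹ := by
  have hs : 0 < Real.sin (Real.pi * c) :=
    Real.sin_pos_of_pos_of_lt_pi (by positivity) (by nlinarith [Real.pi_pos])
  have hz : (Real.pi : ℂ) * (c + t * Complex.I) =
      ((Real.pi * c : ℝ) : ℂ) + ((Real.pi * t : ℝ) : ℂ) * Complex.I := by push_cast; ring
  rw [Complex.Gamma_mul_Gamma_one_sub, hz, norm_div, Complex.norm_real,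
    Real.norm_of_nonneg Real.pi_pos.le, ← div_eq_mul_inv, div_div]
  have hc := Real.one_add_sq_div_two_le_cosh (Real.pi * t)
  have h2 : 1 + t ^ 2 ≤ Real.cosh (Real.pi * t) := by
    refine le_trans ?_ hc
    have : (2 : ℝ) ≤ Real.pi ^ 2 := by nlinarith [Real.pi_gt_three]
    nlinarith [sq_nonneg t]
  gcongr
  exact (mul_le_mul_of_nonneg_left h2 hs.le).trans (Complex.norm_sin_ge_sin_re_mul_cosh_im _ _)

theorem Complex.continuousAt_Gamma_of_re_pos {s : ℂ} (hs : 0 < s.re) :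
    ContinuousAt Complex.Gamma s :=
  Complex.continuousAt_Gamma s fun m h => by
    have := congrArg Complex.re h
    simp at this
    linarith [(Nat.cast_nonneg m : (0 : ℝ) ≤ m)]

theorem Complex.continuous_Gamma_mul_Gamma_one_sub {c : ℝ} (h0 : 0 < c) (h1 : c < 1) :
    Continuous fun t : ℝ =>
      Complex.Gamma (c + t * Complex.I) * Complex.Gamma (1 - (c + t * Complex.I)) :=
  continuous_iff_continuousAt.2 fun t =>
    ((Complex.continuousAt_Gamma_of_re_pos (by simpa)).comp (f := fun t : ℝ => (c + t * Complex.I))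
      (by fun_prop)).mul
    ((Complex.continuousAt_Gamma_of_re_pos (by simpa)).comp
      (f := fun t : ℝ => 1 - (c + t * Complex.I)) (by fun_prop))

theorem Complex.integrable_Gamma_mul_Gamma_one_sub {c : ℝ} (h0 : 0 < c) (h1 : c < 1) :
    Integrable fun t : ℝ =>
      Complex.Gamma (c + t * Complex.I) * Complex.Gamma (1 - (c + t * Complex.I)) :=
  (integrable_inv_one_add_sq.const_mul _).mono'
    (Complex.continuous_Gamma_mul_Gamma_one_sub h0 h1).aestronglyMeasurable
    (ae_of_all _ (Complex.norm_Gamma_mul_Gamma_one_sub_le h0 h1))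

/-! ### The Mellin pair of 1/(1 + y) -/

theorem mellinConvergent_inv_one_add {s : ℂ} (h0 : 0 < s.re) (h1 : s.re < 1) :
    MellinConvergent (fun y : ℝ => ((1 + y)⁻¹ : ℂ)) s := by
  have hb : ∀ y : ℝ, 0 < y → ‖((1 + y)⁻¹ : ℂ)‖ = (1 + y)⁻¹ := fun y hy => by
    rw [← Complex.ofReal_one, ← Complex.ofReal_add, ← Complex.ofReal_inv, Complex.norm_real,
      Real.norm_of_nonneg (by positivity)]
  refine mellinConvergent_of_isBigO_rpow (a := 1) (b := 0) ?_ ?_ h1 ?_ h0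
  · refine ContinuousOn.locallyIntegrableOn (fun y hy => ?_) measurableSet_Ioi
    refine ContinuousAt.continuousWithinAt (ContinuousAt.inv₀ (by fun_prop) ?_)
    rw [← Complex.ofReal_one, ← Complex.ofReal_add]
    exact Complex.ofReal_ne_zero.2 (by have : 0 < y := hy; positivity)
  · refine Asymptotics.IsBigO.of_bound 1 ?_
    filter_upwards [Filter.eventually_gt_atTop 0] with y hy
    rw [hb y hy, Real.rpow_neg_one, Real.norm_of_nonneg (by positivity), one_mul]
    gcongr
    linarith
  · refine Asymptotics.IsBigO.of_bound 1 ?_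
    filter_upwards [self_mem_nhdsWithin] with y hy
    have hy : 0 < y := hy
    rw [hb y hy]
    simpa using inv_le_one_of_one_le₀ (by linarith : 1 ≤ 1 + y)

/-- Write 1/(1 + y) = ∫_0^∞ e^(-(1+y)x) dx and exchange the integrals: the y-integral is Γ(s)
x^(-s), and the remaining x-integral is Γ(1-s). -/
theorem mellin_inv_one_add {s : ℂ} (h0 : 0 < s.re) (h1 : s.re < 1) :
    mellin (fun y : ℝ => ((1 + y)⁻¹ : ℂ)) s = Complex.Gamma s * Complex.Gamma (1 - s) := by
  set μ := volume.restrict (Set.Ioi (0 : ℝ))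
  let f : ℝ → ℝ → ℂ := fun x y => (y : ℂ) ^ (s - 1) * Complex.exp (-((1 + y : ℝ) * x : ℝ))
  have hexp : ∀ y : ℝ, 0 < y →
      Integrable (fun x : ℝ => Complex.exp (-((1 + y : ℝ) * x : ℝ))) μ := fun y hy => by
    have := (exp_neg_integrableOn_Ioi 0 (by positivity : 0 < 1 + y)).ofReal (𝕜 := ℂ)
    refine this.congr (ae_of_all _ fun x => ?_)
    simp only [← Complex.ofReal_neg, neg_mul]
    exact Complex.ofReal_exp _
  have hint : Integrable (Function.uncurry f) (μ.prod μ) := by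
    have hmeas : AEStronglyMeasurable (Function.uncurry f) (μ.prod μ) := by
      refine Measurable.aestronglyMeasurable ?_
      simp only [f, Function.uncurry_def]
      fun_prop
    rw [integrable_prod_iff' hmeas]
    constructor
    · filter_upwards [ae_restrict_mem measurableSet_Ioi] with y hy
      exact (hexp y hy).const_mul ((y : ℂ) ^ (s - 1))
    · refine (mellinConvergent_inv_one_add h0 h1).norm.congr ?_
      filter_upwards [ae_restrict_mem measurableSet_Ioi] with y hy
      have hy : 0 < y := hy
      have := Real.integral_rpow_mul_exp_neg_mul_Ioi one_pos (by positivity : 0 < 1 + y)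
      simp only [sub_self, Real.rpow_zero, one_mul, Real.Gamma_one, Real.rpow_one, mul_one] at this
      simp only [f, Function.uncurry_apply_pair, norm_mul, norm_smul]
      rw [integral_const_mul]
      congr 1
      have h2 : ∀ x : ℝ, ‖Complex.exp (-(((1 + y : ℝ) * x : ℝ) : ℂ))‖ =
          Real.exp (-((1 + y) * x)) := fun x => by
        rw [Complex.norm_exp]; simp
      simp only [h2]
      rw [this, ← Complex.ofReal_one, ← Complex.ofReal_add, ← Complex.ofReal_inv,
        Complex.norm_real, Real.norm_of_nonneg (by positivity), one_div]
  have hswap := integral_integral_swap hint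
  have hl : ∀ y : ℝ, 0 < y → ∫ x, f x y ∂μ = (y : ℂ) ^ (s - 1) • ((1 + y)⁻¹ : ℂ) := fun y hy => by
    have := Complex.integral_cpow_mul_exp_neg_mul_Ioi (a := 1) (r := 1 + y) (by simp)
      (by positivity)
    simp only [sub_self, Complex.cpow_zero, one_mul, Complex.Gamma_one, Complex.cpow_one,
      mul_one] at this
    simp only [f]
    rw [integral_const_mul, smul_eq_mul]
    congr 1
    push_cast at this ⊢
    rw [this, one_div]
  have hr : ∀ x : ℝ, 0 < x →
      ∫ y, f x y ∂μ = (Complex.exp (-x) * (x : ℂ) ^ ((1 - s) - 1)) * Complex.Gamma s :=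
    fun x hx => by
    have := Complex.integral_cpow_mul_exp_neg_mul_Ioi h0 hx
    have h2 : ∀ y, f x y = Complex.exp (-x) * ((y : ℂ) ^ (s - 1) * Complex.exp (-(x * y))) :=
      fun y => by
        simp only [f]
        rw [mul_left_comm, ← Complex.exp_add]
        push_cast
        ring_nf
    simp only [h2]
    rw [integral_const_mul, this, one_div, ← mul_assoc]
    congr 2
    rw [Complex.inv_cpow _ _ (by rw [Complex.arg_ofReal_of_nonneg hx.le]; exact Real.pi_pos.ne),
      ← Complex.cpow_neg]
    ring_nf
  rw [mellin, ← setIntegral_congr_fun measurableSet_Ioi hl, ← hswap,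
    setIntegral_congr_fun measurableSet_Ioi hr, integral_mul_const, mul_comm,
    Complex.Gamma_eq_integral (s := 1 - s) (by simpa), Complex.GammaIntegral]
  simp only [Complex.ofReal_exp, Complex.ofReal_neg]

/-- The Mellin–Barnes representation of `y / (1 + y)`. -/
theorem integral_Gamma_mul_Gamma_one_sub_mul_cpow {c y : ℝ} (h0 : 0 < c) (h1 : c < 1)
    (hy : 0 < y) :
    ∫ t : ℝ, Complex.Gamma (c + t * Complex.I) * Complex.Gamma (1 - (c + t * Complex.I)) *
      (y : ℂ) ^ (c + t * Complex.I) = 2 * Real.pi * ((y / (1 + y) : ℝ) : ℂ) := by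
  have hm : ∀ t : ℝ, mellin (fun y : ℝ => ((1 + y)⁻¹ : ℂ)) (c + t * Complex.I) =
      Complex.Gamma (c + t * Complex.I) * Complex.Gamma (1 - (c + t * Complex.I)) := fun t =>
    mellin_inv_one_add (by simpa) (by simpa)
  -- Inversion is applied at y⁻¹, since (y⁻¹)^(-s) = y^s and 1/(1 + y⁻¹) = y/(1 + y).
  have h := mellinInv_mellin_eq c (fun y : ℝ => ((1 + y)⁻¹ : ℂ)) (inv_pos.2 hy)
    (mellinConvergent_inv_one_add (by simpa) (by simpa))
    (by
      rw [Complex.VerticalIntegrable]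
      simpa only [hm] using Complex.integrable_Gamma_mul_Gamma_one_sub h0 h1)
    (ContinuousAt.inv₀ (by fun_prop) (by
      rw [← Complex.ofReal_one, ← Complex.ofReal_add]
      exact Complex.ofReal_ne_zero.2 (by positivity)))
  have hp : ∀ t : ℝ, ((y⁻¹ : ℝ) : ℂ) ^ (-(c + t * Complex.I)) = (y : ℂ) ^ (c + t * Complex.I) :=
    fun t => by
    rw [Complex.ofReal_inv, Complex.inv_cpow _ _
      (by rw [Complex.arg_ofReal_of_nonneg hy.le]; exact Real.pi_pos.ne), Complex.cpow_neg, inv_inv]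
  rw [mellinInv] at h
  simp only [hm, hp, smul_eq_mul] at h
  rw [Complex.real_smul] at h
  have hpi : (Real.pi : ℂ) ≠ 0 := Complex.ofReal_ne_zero.2 Real.pi_pos.ne'
  have hv : ((1 : ℂ) + ((y⁻¹ : ℝ) : ℂ))⁻¹ = ((y / (1 + y) : ℝ) : ℂ) := by
    rw [← Complex.ofReal_one, ← Complex.ofReal_add, ← Complex.ofReal_inv]
    congr 1
    field_simp
    ring
  rw [← hv, ← h, integral_congr_ae (ae_of_all _ fun t => mul_comm _ _), ← mul_assoc]
  have h2 : 2 * (Real.pi : ℂ) * ((1 / (2 * Real.pi) : ℝ) : ℂ) = 1 := by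
    push_cast
    field_simp
  rw [h2, one_mul]

/-! ### The H-function as a real integral -/

/-- Collects all powers of u into one exponent, which becomes the argument of the joint Gamma
factor. Positive bases make the complex power laws valid. -/
theorem Complex.cpow_mul_prod_rpow_cpow {ι : Type*} (S : Finset ι) {u : ℝ} (hu : 0 < u)
    {z : ι → ℝ} (hz : ∀ l, 0 < z l) (β : ι → ℝ) (a : ℂ) (s : ι → ℂ) :
    (u : ℂ) ^ a * ∏ l ∈ S, ((z l * u ^ β l : ℝ) : ℂ) ^ s l =
      (u : ℂ) ^ (a + ∑ l ∈ S, (β l : ℂ) * s l) * ∏ l ∈ S, (z l : ℂ) ^ s l := by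
  have hu' : (u : ℂ) ≠ 0 := Complex.ofReal_ne_zero.2 hu.ne'
  have h : ∀ l, ((z l * u ^ β l : ℝ) : ℂ) ^ s l = (u : ℂ) ^ ((β l : ℂ) * s l) * (z l : ℂ) ^ s l :=
    fun l => by
    rw [Complex.ofReal_mul, Complex.mul_cpow_ofReal_nonneg (hz l).le (by positivity), mul_comm,
      Complex.cpow_def_of_ne_zero (Complex.ofReal_ne_zero.2 (Real.rpow_pos_of_pos hu _).ne'),
      Complex.cpow_def_of_ne_zero hu', ← Complex.ofReal_log (by positivity), Real.log_rpow hu,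
      ← Complex.ofReal_log hu.le]
    push_cast
    ring_nf
  simp only [h, Finset.prod_mul_distrib]
  rw [Complex.cpow_add _ _ hu', ← mul_assoc]
  congr 2
  simp only [Complex.cpow_def_of_ne_zero hu', ← Complex.exp_sum, Finset.mul_sum]

section

variable {L : ℕ} {β z c : Fin L → ℝ}

theorem berFoxHParams_integrand (β : Fin L → ℝ) (z s : Fin L → ℂ) :
    (berFoxHParams β).integrand z s =
      Complex.Gamma (1 / 2 + ∑ l, (β l : ℂ) * s l) *
        ∏ l, Complex.Gamma (s l) * Complex.Gamma (1 - s l) * z l ^ s l := by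
  have hpsi : (berFoxHParams β).psi s = Complex.Gamma (1 / 2 + ∑ l, (β l : ℂ) * s l) := by
    change (∏ j : Fin 1, if (j : ℕ) < 1 then Complex.Gamma (1 - 1 / 2 + ∑ l, (β l : ℂ) * s l)
      else (Complex.Gamma (1 / 2 - ∑ l, (β l : ℂ) * s l))⁻¹) *
      ∏ j : Fin 0, (Complex.Gamma (1 - 0 + ∑ l, ((0 : ℝ) : ℂ) * s l))⁻¹ = _
    norm_num
  have hphi : ∀ l, (berFoxHParams β).phi l (s l) =
      Complex.Gamma (s l) * Complex.Gamma (1 - s l) := fun l => by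
    change (∏ j : Fin 1, if (j : ℕ) < 1 then Complex.Gamma (1 - 1 + ((1 : ℝ) : ℂ) * s l)
      else (Complex.Gamma (1 - ((1 : ℝ) : ℂ) * s l))⁻¹) *
      (∏ j : Fin 1, if (j : ℕ) < 1 then Complex.Gamma (1 - ((1 : ℝ) : ℂ) * s l)
      else (Complex.Gamma (1 - 1 + ((1 : ℝ) : ℂ) * s l))⁻¹) = _
    simp
  simp only [FoxHParams.integrand, hpsi, hphi]

theorem berFoxHParams_separates (hβ : ∀ l, 0 < β l) :
    (berFoxHParams β).Separates c ↔ ∀ l, 0 < c l ∧ c l < 1 := by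
  constructor
  · intro h l
    have h1 := h.left_i l ⟨0, Nat.one_pos⟩ Nat.one_pos
    have h2 := h.right_i l ⟨0, Nat.one_pos⟩ Nat.one_pos
    simp only [berFoxHParams] at h1 h2
    norm_num at h1 h2
    exact ⟨h1, h2⟩
  · intro h
    refine ⟨fun j _ => ?_, fun i j _ => ?_, fun i j _ => ?_⟩
    -- The joint Gamma factor adds no constraint, as 1/2 + ∑ β_i c_i is already positive.
    · have : 0 ≤ ∑ i, β i * c i := Finset.sum_nonneg fun i _ => (mul_pos (hβ i) (h i).1).le
      simp only [berFoxHParams]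
      norm_num
      linarith
    · simpa [berFoxHParams] using (h i).1
    · simpa [berFoxHParams] using (h i).2

theorem berFoxHParams_wellFormed (hβ : ∀ l, 0 < β l) : (berFoxHParams β).WellFormed where
  n_le := le_rfl
  mv_le _ := le_rfl
  nv_le _ := le_rfl
  A_pos _ i := hβ i
  B_pos j := j.elim0
  C_pos _ _ := one_pos
  D_pos _ _ := one_pos

/-- The kernel whose integral over `u` is the Mellin–Barnes integrand and whose integral over `t`
is elementary. -/
noncomputable def berKernel (β z c : Fin L → ℝ) (u : ℝ) (t : Fin L → ℝ) : ℂ :=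
  Complex.exp (-u) * (u : ℂ) ^ (-(1 / 2) : ℂ) *
    ∏ l, (Complex.Gamma (c l + t l * Complex.I) * Complex.Gamma (1 - (c l + t l * Complex.I)) *
      ((z l * u ^ β l : ℝ) : ℂ) ^ (c l + t l * Complex.I))

/-- The modulus of a positive real raised to s depends only on Re s. Hence the modulus of the kernel
is exactly a Gamma integrand in u, at 1/2 + ∑ β_l c_l, times a product of integrable functions of
the single t_l. -/
theorem integrable_berKernel (hβ : ∀ l, 0 < β l) (hz : ∀ l, 0 < z l)
    (hc : ∀ l, 0 < c l ∧ c l < 1) :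
    Integrable (Function.uncurry (berKernel β z c))
      ((volume.restrict (Set.Ioi (0 : ℝ))).prod volume) := by
  have hσ : 0 < 1 / 2 + ∑ l, β l * c l :=
    add_pos_of_pos_of_nonneg one_half_pos
      (Finset.sum_nonneg fun l _ => (mul_pos (hβ l) (hc l).1).le)
  have hu := Real.GammaIntegral_convergent hσ
  have ht : Integrable (fun t : Fin L → ℝ => ∏ l,
      ‖Complex.Gamma (c l + t l * Complex.I) * Complex.Gamma (1 - (c l + t l * Complex.I))‖ *
        z l ^ c l) := by
    refine Integrable.fintype_prod (𝕜 := ℝ) (E := ℝ) (f := fun l (x : ℝ) =>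
      ‖Complex.Gamma (c l + x * Complex.I) * Complex.Gamma (1 - (c l + x * Complex.I))‖ *
        z l ^ c l) fun l => ?_
    exact (Complex.integrable_Gamma_mul_Gamma_one_sub (hc l).1 (hc l).2).norm.mul_const _
  refine (Integrable.mul_prod hu ht).mono' ?_ ?_
  · refine Measurable.aestronglyMeasurable ?_
    unfold berKernel
    simp only [Function.uncurry_def]
    refine Measurable.mul (by fun_prop) (Finset.measurable_prod _ fun l _ => ?_)
    refine Measurable.mul ?_ (by fun_prop)
    exact ((Complex.continuous_Gamma_mul_Gamma_one_sub (hc l).1 (hc l).2).comp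
      ((continuous_apply l).comp continuous_snd)).measurable
  · have hpos : ∀ᵐ p ∂((volume.restrict (Set.Ioi (0 : ℝ))).prod (volume : Measure (Fin L → ℝ))),
        0 < p.1 :=
      Measure.quasiMeasurePreserving_fst.ae (ae_restrict_mem measurableSet_Ioi)
    filter_upwards [hpos] with p hp
    obtain ⟨u, t⟩ := p
    have hp : 0 < u := hp
    simp only [Function.uncurry_apply_pair, berKernel]
    rw [Finset.prod_mul_distrib, mul_assoc, mul_left_comm _ (∏ l, _),
      Complex.cpow_mul_prod_rpow_cpow _ hp hz]
    simp only [norm_mul, norm_prod, Complex.norm_cpow_eq_rpow_re_of_pos hp,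
      Complex.norm_cpow_eq_rpow_re_of_pos (hz _), Finset.prod_mul_distrib, Complex.norm_exp]
    refine le_of_eq ?_
    have e1 : (-(1 / 2) + ∑ l, (β l : ℂ) * (c l + t l * Complex.I)).re =
        1 / 2 + ∑ l, β l * c l - 1 := by
      simp
      ring
    rw [e1]
    simp
    ring

theorem integral_berKernel_left (hβ : ∀ l, 0 < β l) (hz : ∀ l, 0 < z l)
    (hc : ∀ l, 0 < c l ∧ c l < 1) (t : Fin L → ℝ) :
    ∫ u in Set.Ioi (0 : ℝ), berKernel β z c u t =
      (berFoxHParams β).integrand (fun l => (z l : ℂ)) (FoxHParams.linePoint c t) := by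
  have hσ : 0 < (1 / 2 + ∑ l, (β l : ℂ) * (c l + t l * Complex.I)).re := by
    simp only [Complex.add_re, Complex.re_sum]
    refine add_pos_of_pos_of_nonneg (by norm_num) (Finset.sum_nonneg fun l _ => ?_)
    simpa using (mul_pos (hβ l) (hc l).1).le
  have h : ∀ u ∈ Set.Ioi (0 : ℝ), berKernel β z c u t =
      (∏ l, Complex.Gamma (c l + t l * Complex.I) * Complex.Gamma (1 - (c l + t l * Complex.I)) *
        (z l : ℂ) ^ (c l + t l * Complex.I)) *
      (Real.exp (-u) * (u : ℂ) ^ ((1 / 2 + ∑ l, (β l : ℂ) * (c l + t l * Complex.I)) - 1)) :=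
    fun u hu => by
    have e1 : (1 / 2 + ∑ l, (β l : ℂ) * (c l + t l * Complex.I)) - 1 =
        -(1 / 2) + ∑ l, (β l : ℂ) * (c l + t l * Complex.I) := by ring
    rw [berKernel, Finset.prod_mul_distrib, mul_assoc, mul_left_comm _ (∏ l, _),
      Complex.cpow_mul_prod_rpow_cpow _ hu hz, e1]
    simp only [Finset.prod_mul_distrib]
    push_cast
    ring
  rw [setIntegral_congr_fun measurableSet_Ioi h, integral_const_mul, berFoxHParams_integrand,
    Complex.Gamma_eq_integral (by exact hσ), Complex.GammaIntegral, mul_comm]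
  rfl

theorem integral_berKernel_right (hz : ∀ l, 0 < z l)
    (hc : ∀ l, 0 < c l ∧ c l < 1) {u : ℝ} (hu : 0 < u) :
    ∫ t, berKernel β z c u t =
      (2 * Real.pi) ^ L * ((u ^ (-(1 / 2) : ℝ) * Real.exp (-u) *
        ∏ l, z l * u ^ β l / (1 + z l * u ^ β l) : ℝ) : ℂ) := by
  unfold berKernel
  rw [integral_const_mul]
  have h := integral_fintype_prod_eq_prod (𝕜 := ℂ) (E := fun _ : Fin L => ℝ)
    (μ := fun _ => volume) (fun l (x : ℝ) =>
      Complex.Gamma (c l + x * Complex.I) * Complex.Gamma (1 - (c l + x * Complex.I)) *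
      ((z l * u ^ β l : ℝ) : ℂ) ^ (c l + x * Complex.I))
  rw [volume_pi, h, Finset.prod_congr rfl fun l _ =>
    integral_Gamma_mul_Gamma_one_sub_mul_cpow (hc l).1 (hc l).2
      (mul_pos (hz l) (Real.rpow_pos_of_pos hu (β l)))]
  rw [Finset.prod_mul_distrib, Finset.prod_const, Finset.card_univ, Fintype.card_fin]
  have e : (u : ℂ) ^ (-(1 / 2) : ℂ) = ((u ^ (-(1 / 2) : ℝ) : ℝ) : ℂ) := by
    rw [Complex.ofReal_cpow hu.le]
    norm_num
  rw [e]
  push_cast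
  ring

/-- Integrating the kernel over t first gives a function of u free of c, so independence of the
lines needs no contour shift. -/
theorem berFoxHParams_hasValue (hβ : ∀ l, 0 < β l) (hz : ∀ l, 0 < z l) :
    (berFoxHParams β).HasValue (fun l => (z l : ℂ))
      ((∫ u in Set.Ioi (0 : ℝ), u ^ (-(1 / 2) : ℝ) * Real.exp (-u) *
        ∏ l, z l * u ^ β l / (1 + z l * u ^ β l) : ℝ) : ℂ) where
  wellFormed := berFoxHParams_wellFormed hβ
  ne_zero l := Complex.ofReal_ne_zero.2 (hz l).ne'
  exists_separates := ⟨fun _ => 1 / 2, (berFoxHParams_separates hβ).2 fun _ => by norm_num⟩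
  integrable c hc := by
    rw [berFoxHParams_separates hβ] at hc
    refine (integrable_berKernel hβ hz hc).integral_prod_right.congr (ae_of_all _ fun t => ?_)
    exact integral_berKernel_left hβ hz hc t
  eq_value c hc := by
    rw [berFoxHParams_separates hβ] at hc
    rw [FoxHParams.mellinBarnes, integral_mul_const]
    simp only [← integral_berKernel_left hβ hz hc]
    rw [← integral_integral_swap (integrable_berKernel hβ hz hc),
      setIntegral_congr_fun measurableSet_Ioi
        (fun u (hu : 0 < u) => integral_berKernel_right hz hc hu),
      integral_const_mul, integral_complex_ofReal]
    rw [mul_comm _ (Complex.I ^ L), ← mul_assoc, ← mul_assoc, ← mul_pow, ← mul_pow]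
    -- Per variable: the prefactor 1/(2πi), the i from ds = i dt, and the 2π from Mellin inversion.
    have : 1 / (2 * (Real.pi : ℂ) * Complex.I) * Complex.I * (2 * Real.pi) = 1 := by
      have hpi : (Real.pi : ℂ) ≠ 0 := Complex.ofReal_ne_zero.2 Real.pi_pos.ne'
      field_simp
    rw [this, one_pow, one_mul]

end

/-- Values are unique: a separating line exists, and its integral equals every admissible value. -/
theorem FoxHParams.HasValue.foxH_eq {r : ℕ} {H : FoxHParams r} {z : Fin r → ℂ} {w : ℂ}
    (h : H.HasValue z w) : H.foxH z = w := by
  have hex : ∃ w, H.HasValue z w := ⟨w, h⟩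
  obtain ⟨x, hx⟩ := h.exists_separates
  rw [FoxHParams.foxH, dif_pos hex, ← hex.choose_spec.eq_value x hx, h.eq_value x hx]

/-! ### Log-logistic distribution functions and existence of a density -/

/-- Since 0^b = 0 for b > 0, this form covers both branches at once and makes continuity at 0
visible. -/
theorem logLogisticCDF_eq {a b : ℝ} (ha : 0 < a) (hb : 0 < b) (x : ℝ) :
    logLogisticCDF a b x = (max x 0 / a) ^ b / (1 + (max x 0 / a) ^ b) := by
  unfold logLogisticCDF
  split_ifs with hx
  · rw [max_eq_left hx.le]
    have : 0 < (x / a) ^ b := by positivity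
    rw [Real.rpow_neg (by positivity)]
    field_simp
    ring
  · rw [max_eq_right (not_lt.1 hx), zero_div, Real.zero_rpow hb.ne', zero_div]

theorem continuous_logLogisticCDF {a b : ℝ} (ha : 0 < a) (hb : 0 < b) :
    Continuous (logLogisticCDF a b) := by
  rw [funext (logLogisticCDF_eq ha hb)]
  have h : Continuous fun x : ℝ => (max x 0 / a) ^ b :=
    Continuous.rpow_const (by fun_prop) fun _ => Or.inr hb.le
  refine h.div (continuous_const.add h) fun x => ?_
  have : 0 ≤ max x 0 := le_max_right _ _
  positivity

theorem differentiableAt_logLogisticCDF {a b x : ℝ} (ha : 0 < a) (hx : 0 < x) :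
    DifferentiableAt ℝ (logLogisticCDF a b) x := by
  have h : logLogisticCDF a b =ᶠ[nhds x] fun x => 1 / (1 + (x / a) ^ (-b)) := by
    filter_upwards [lt_mem_nhds hx] with y hy
    simp [logLogisticCDF, hy]
  refine DifferentiableAt.congr_of_eventuallyEq ?_ h
  have hd : DifferentiableAt ℝ (fun x : ℝ => (x / a) ^ (-b)) x :=
    (differentiableAt_id.div_const a).rpow_const (Or.inl (by simp; constructor <;> positivity))
  exact (differentiableAt_const _).div ((differentiableAt_const _).add hd) (by positivity)

/-- Differentiability at 0 is not asked for: it fails for log-logistic shape at most 1. A derivative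
at every point of (0, x), being nonnegative, is integrable, and the fundamental theorem of calculus
recovers the distribution function, so the measure has the derivative as density. -/
theorem absolutelyContinuous_of_differentiableAt_cdf {μ : Measure ℝ} [IsProbabilityMeasure μ]
    (hcont : Continuous (cdf μ)) (hdiff : ∀ x, 0 < x → DifferentiableAt ℝ (cdf μ) x)
    (h0 : cdf μ 0 = 0) : μ ≪ volume := by
  have hnn : ∀ x, 0 ≤ deriv (cdf μ) x := fun x => (monotone_cdf μ).deriv_nonneg
  have hneg : ∀ x ≤ 0, cdf μ x = 0 := fun x hx =>
    le_antisymm (h0 ▸ monotone_cdf μ hx) (cdf_nonneg μ x)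
  suffices h : μ = (volume.restrict (Set.Ioi 0)).withDensity
      fun x => ENNReal.ofReal (deriv (cdf μ) x) by
    rw [h]
    exact (withDensity_absolutelyContinuous _ _).trans Measure.absolutelyContinuous_restrict
  refine Measure.ext_of_Iic _ _ fun x => ?_
  rw [← ofReal_cdf, withDensity_apply _ measurableSet_Iic,
    Measure.restrict_restrict measurableSet_Iic, Set.inter_comm, Set.Ioi_inter_Iic]
  rcases le_or_gt x 0 with hx | hx
  · rw [hneg x hx, Set.Ioc_eq_empty (not_lt.2 hx)]
    simp
  · have hd : ∀ y ∈ Set.Ioo 0 x, HasDerivAt (cdf μ) (deriv (cdf μ) y) y :=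
      fun y hy => (hdiff y hy.1).hasDerivAt
    have hint : IntegrableOn (deriv (cdf μ)) (Set.Ioc 0 x) :=
      intervalIntegral.integrableOn_deriv_of_nonneg hcont.continuousOn hd fun y _ => hnn y
    rw [← ofReal_integral_eq_lintegral_ofReal hint (ae_of_all _ hnn),
      ← intervalIntegral.integral_of_le hx.le,
      intervalIntegral.integral_eq_sub_of_hasDerivAt_of_le hx.le hcont.continuousOn hd
        ((intervalIntegrable_iff_integrableOn_Ioc_of_le hx.le).2 hint), h0, sub_zero]

/-! ### Averaging erfc against a law on (0, ∞) -/

theorem integrableOn_rpow_neg_half_mul_exp_neg :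
    IntegrableOn (fun u : ℝ => u ^ (-(1 / 2) : ℝ) * Real.exp (-u)) (Set.Ioi 0) := by
  have h := Real.GammaIntegral_convergent (s := 1 / 2) one_half_pos
  refine h.congr (ae_of_all _ fun u => ?_)
  simp only
  rw [mul_comm]
  norm_num

/-- Substitution t = u^(1/2). -/
theorem erfc_sqrt {a : ℝ} (ha : 0 ≤ a) :
    erfc (Real.sqrt a) = 1 / Real.sqrt Real.pi *
      ∫ u in Set.Ioi a, u ^ (-(1 / 2) : ℝ) * Real.exp (-u) := by
  have h := integral_comp_rpow_Ioi_of_pos' (g := fun t : ℝ => Real.exp (-t ^ 2)) (p := 1 / 2)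
    one_half_pos (Real.sqrt_nonneg a)
  have e : Real.sqrt a ^ (1 / 2 : ℝ)⁻¹ = a := by
    rw [one_div, inv_inv, Real.rpow_two, Real.sq_sqrt ha]
  rw [e] at h
  have e2 : ∀ x ∈ Set.Ioi a, ((1 / 2 : ℝ) * x ^ (1 / 2 - 1 : ℝ)) • Real.exp (-(x ^ (1 / 2 : ℝ)) ^ 2) =
      1 / 2 * (x ^ (-(1 / 2) : ℝ) * Real.exp (-x)) := fun x hx => by
    have hx : 0 ≤ x := ha.trans (le_of_lt hx)
    rw [← Real.sqrt_eq_rpow, Real.sq_sqrt hx, smul_eq_mul, mul_assoc]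
    norm_num
  rw [setIntegral_congr_fun measurableSet_Ioi e2, integral_const_mul] at h
  rw [erfc, ← h]
  ring

/-- Fubini on the region ζx < u, in place of integration by parts: for fixed u the x-integral is the
mass below u/ζ. -/
theorem integral_erfc_sqrt {μ : Measure ℝ} [IsProbabilityMeasure μ] (hac : μ ≪ volume)
    (h0 : cdf μ 0 = 0) {ζ : ℝ} (hζ : 0 < ζ) :
    Integrable (fun x => erfc (Real.sqrt (ζ * x))) μ ∧
    ∫ x, erfc (Real.sqrt (ζ * x)) ∂μ = 1 / Real.sqrt Real.pi *
      ∫ u in Set.Ioi (0 : ℝ), u ^ (-(1 / 2) : ℝ) * Real.exp (-u) * cdf μ (u / ζ) := by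
  have : NullSingletonClass μ := ⟨fun x => hac (by simp)⟩
  set k : ℝ → ℝ := fun u => u ^ (-(1 / 2) : ℝ) * Real.exp (-u)
  have hpos : ∀ᵐ x ∂μ, 0 < x := by
    rw [ae_iff]
    have : {x : ℝ | ¬ 0 < x} = Set.Iic 0 := by ext; simp
    rw [this, ← ofReal_cdf, h0, ENNReal.ofReal_zero]
  let T : Set (ℝ × ℝ) := {p | ζ * p.1 < p.2}
  have hT : MeasurableSet T := measurableSet_lt (by fun_prop) (by fun_prop)
  have hint : Integrable (T.indicator fun p => k p.2)
      (μ.prod (volume.restrict (Set.Ioi (0 : ℝ)))) := by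
    refine Integrable.indicator ?_ hT
    simpa only [one_mul] using Integrable.mul_prod (integrable_const (1 : ℝ) (μ := μ))
      integrableOn_rpow_neg_half_mul_exp_neg
  have hinner : ∀ x, 0 < x → ∫ u in Set.Ioi (0 : ℝ), T.indicator (fun p => k p.2) (x, u) =
      ∫ u in Set.Ioi (ζ * x), k u := fun x hx => by
    have : ∀ u, T.indicator (fun p => k p.2) (x, u) = (Set.Ioi (ζ * x)).indicator k u := fun u => by
      simp [Set.indicator_apply, T]
    simp only [this]
    rw [setIntegral_indicator measurableSet_Ioi, Set.inter_eq_right.2]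
    exact Set.Ioi_subset_Ioi (by positivity)
  have heq : ∀ᵐ x ∂μ, 1 / Real.sqrt Real.pi *
      ∫ u in Set.Ioi (0 : ℝ), T.indicator (fun p => k p.2) (x, u) =
      erfc (Real.sqrt (ζ * x)) := by
    filter_upwards [hpos] with x hx
    rw [hinner x hx, erfc_sqrt (by positivity)]
  refine ⟨(hint.integral_prod_left.const_mul _).congr heq, ?_⟩
  rw [← integral_congr_ae heq, integral_const_mul]
  congr 1
  rw [integral_integral_swap (f := fun x u => T.indicator (fun p => k p.2) (x, u)) hint]
  refine integral_congr_ae (ae_of_all _ fun u => ?_)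
  have : ∀ x, T.indicator (fun p => k p.2) (x, u) =
      (Set.Iio (u / ζ)).indicator (fun _ => k u) x := fun x => by
    simp [Set.indicator_apply, T, lt_div_iff₀' hζ]
  simp only [this]
  -- The mass of the open half-line equals the distribution function because the law has no atoms.
  rw [integral_indicator_const _ measurableSet_Iio, smul_eq_mul, mul_comm, cdf_eq_real,
    measureReal_congr Iio_ae_eq_Iic]

/-- The density is the Radon–Nikodym derivative of the law, and restricting to (0, ∞) loses no mass.
-/
theorem integral_pdf_mul_Ioi {Ω : Type*} [MeasurableSpace Ω] {P : Measure Ω}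
    [IsProbabilityMeasure P] {X : Ω → ℝ} [HasPDF X P volume] (h0 : cdf (P.map X) 0 = 0)
    {g : ℝ → ℝ} (hg : Integrable g (P.map X)) :
    IntegrableOn (fun x => g x * (pdf X P volume x).toReal) (Set.Ioi 0) ∧
    ∫ x in Set.Ioi 0, g x * (pdf X P volume x).toReal = ∫ x, g x ∂(P.map X) := by
  have hac : P.map X ≪ volume := HasPDF.absolutelyContinuous
  have : IsProbabilityMeasure (P.map X) :=
    Measure.isProbabilityMeasure_map (HasPDF.aemeasurable X P volume)
  simp only [mul_comm (g _), ← smul_eq_mul, pdf_def]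
  refine ⟨((integrable_rnDeriv_smul_iff hac).2 hg).integrableOn, ?_⟩
  have h : P.map X (Set.Iic 0) = 0 := by rw [← ofReal_cdf, h0, ENNReal.ofReal_zero]
  have hr : (P.map X).restrict (Set.Ioi 0) = P.map X := by
    refine Measure.restrict_eq_self_of_ae_mem ?_
    rw [ae_iff]
    simpa [Set.Iic_def] using h
  rw [setIntegral_rnDeriv_smul hac measurableSet_Ioi, hr]

/-! ### Laws of the branch and output signal-to-noise ratios -/

section

variable {Ω : Type*} [MeasurableSpace Ω] {P : Measure Ω} [IsProbabilityMeasure P] {L : ℕ}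
  {ρ : ℝ} {h : Fin L → Ω → ℂ}

theorem IsLogLogistic.branchSNR {a b : ℝ} {l : Fin L}
    (hl : IsLogLogistic (fun ω => ‖h l ω‖) a b P) (hρ : 0 < ρ) :
    IsLogLogistic (branchSNR ρ h l) (ρ * a ^ 2) (b / 2) P := by
  obtain ⟨ha, hb, hm, hc⟩ := hl
  have hm' : AEMeasurable (_root_.branchSNR ρ h l) P := (hm.pow_const 2).const_mul ρ
  refine ⟨by positivity, by positivity, hm', fun x => ?_⟩
  have := Measure.isProbabilityMeasure_map (μ := P) hm'
  have := Measure.isProbabilityMeasure_map (μ := P) hm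
  rw [cdf_eq_real, map_measureReal_apply_of_aemeasurable hm' measurableSet_Iic]
  rcases lt_or_ge x 0 with hx | hx
  · have : _root_.branchSNR ρ h l ⁻¹' Set.Iic x = ∅ := by
      ext ω
      simp only [Set.mem_preimage, Set.mem_Iic, Set.mem_empty_iff_false, iff_false, not_le]
      exact hx.trans_le (by unfold _root_.branchSNR; positivity)
    rw [this, measureReal_empty, logLogisticCDF, if_neg hx.le.not_gt]
  · have hs : _root_.branchSNR ρ h l ⁻¹' Set.Iic x =
        (fun ω => ‖h l ω‖) ⁻¹' Set.Iic (Real.sqrt (x / ρ)) := by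
      ext ω
      simp only [Set.mem_preimage, Set.mem_Iic, _root_.branchSNR]
      rw [Real.le_sqrt (norm_nonneg _) (by positivity), le_div_iff₀' hρ]
    rw [hs, ← map_measureReal_apply_of_aemeasurable hm measurableSet_Iic, ← cdf_eq_real, hc]
    unfold logLogisticCDF
    -- At x = 0 both distribution functions take their `else` value 0.
    rcases hx.eq_or_lt with rfl | hx
    · simp
    · rw [if_pos hx, if_pos (by positivity)]
      congr 2
      have e : Real.sqrt (x / ρ) / a = (x / (ρ * a ^ 2)) ^ (1 / 2 : ℝ) := by
        rw [← Real.sqrt_eq_rpow, ← div_div, Real.sqrt_div' (x / ρ) (sq_nonneg a), Real.sqrt_sq ha.le]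
      rw [e, ← Real.rpow_mul (by positivity)]
      congr 1
      ring

theorem cdf_scSNR (hL : 1 ≤ L) {a b : Fin L → ℝ}
    (hlaw : ∀ l, IsLogLogistic (branchSNR ρ h l) (a l) (b l) P)
    (hindep : iIndepFun (fun l => branchSNR ρ h l) P) (x : ℝ) :
    cdf (P.map (scSNR ρ h)) x = ∏ l, logLogisticCDF (a l) (b l) x := by
  -- For L = 0 the supremum is the constant 0 but the empty product is 1, so the formula fails at
  -- negative x.
  have : NeZero L := ⟨by omega⟩
  have hm : AEMeasurable (scSNR ρ h) P := AEMeasurable.iSup fun l => (hlaw l).2.2.1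
  have := Measure.isProbabilityMeasure_map (μ := P) hm
  have hs : scSNR ρ h ⁻¹' Set.Iic x = ⋂ l ∈ Finset.univ, branchSNR ρ h l ⁻¹' Set.Iic x := by
    ext ω
    simp [scSNR, ciSup_le_iff (Set.finite_range _).bddAbove]
  rw [cdf_eq_real, map_measureReal_apply_of_aemeasurable hm measurableSet_Iic, hs, measureReal_def,
    hindep.measure_inter_preimage_eq_mul _ fun _ _ => measurableSet_Iic, ENNReal.toReal_prod]
  refine Finset.prod_congr rfl fun l _ => ?_
  have := Measure.isProbabilityMeasure_map (μ := P) (hlaw l).2.2.1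
  rw [← (hlaw l).2.2.2 x, cdf_eq_real,
    map_measureReal_apply_of_aemeasurable (hlaw l).2.2.1 measurableSet_Iic, measureReal_def]

end

theorem theorem1 {Ω : Type*} [MeasurableSpace Ω] (P : Measure Ω) [IsProbabilityMeasure P]
    (L : ℕ) (hL : 1 ≤ L) (ρ : ℝ) (hρ : 0 < ρ) (δ ζ : ℝ) (hζ : 0 < ζ)
    (h : Fin L → Ω → ℂ) (α' β' α β : Fin L → ℝ)
    (hlaw : ∀ l, IsLogLogistic (fun ω => ‖h l ω‖) (α' l) (β' l) P)
    (hindep : iIndepFun (fun l => branchSNR ρ h l) P)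
    (hα : ∀ l, α l = α' l ^ 2) (hβ : ∀ l, β l = β' l / 2) :
    HasPDF (scSNR ρ h) P volume ∧
    IntegrableOn (berIntegrand P (scSNR ρ h) δ ζ) (Set.Ioi 0) ∧
    (berFoxHParams β).HasValue (fun l => (((ζ * ρ * α l) ^ (-β l) : ℝ) : ℂ))
      ((berFoxHParams β).foxH (fun l => (((ζ * ρ * α l) ^ (-β l) : ℝ) : ℂ))) ∧
    (averageBER P (scSNR ρ h) δ ζ : ℂ) =
      ((δ / Real.sqrt Real.pi : ℝ) : ℂ) *
        (berFoxHParams β).foxH (fun l => (((ζ * ρ * α l) ^ (-β l) : ℝ) : ℂ)) := by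

  have hα' : ∀ l, 0 < α' l := fun l => (hlaw l).1
  have hβ' : ∀ l, 0 < β l := fun l => by rw [hβ]; exact half_pos (hlaw l).2.1
  have ha : ∀ l, 0 < ρ * α l := fun l => by rw [hα]; exact mul_pos hρ (pow_pos (hα' l) 2)
  have hbr : ∀ l, IsLogLogistic (branchSNR ρ h l) (ρ * α l) (β l) P := fun l => by
    rw [hα, hβ]
    exact (hlaw l).branchSNR hρ
  have hz : ∀ l, 0 < (ζ * ρ * α l) ^ (-β l) := fun l =>
    Real.rpow_pos_of_pos (by rw [mul_assoc]; exact mul_pos hζ (ha l)) _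
  have hm : AEMeasurable (scSNR ρ h) P := AEMeasurable.iSup fun l => (hbr l).2.2.1
  have hprob := Measure.isProbabilityMeasure_map (μ := P) hm
  have hcdf := cdf_scSNR hL hbr hindep
  have h0 : cdf (P.map (scSNR ρ h)) 0 = 0 := by
    rw [hcdf]
    exact Finset.prod_eq_zero (Finset.mem_univ (⟨0, hL⟩ : Fin L)) (by simp [logLogisticCDF])
  have hac : P.map (scSNR ρ h) ≪ volume := by
    refine absolutelyContinuous_of_differentiableAt_cdf ?_ (fun x hx => ?_) h0
    · rw [funext hcdf]
      exact continuous_finsetProd _ fun l _ => continuous_logLogisticCDF (ha l) (hβ' l)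
    · rw [funext hcdf]
      exact DifferentiableAt.fun_finsetProd fun l _ => differentiableAt_logLogisticCDF (ha l) hx
  have hpdf : HasPDF (scSNR ρ h) P volume := (Real.hasPDF_iff_of_aemeasurable hm).2 hac
  obtain ⟨hint, hval⟩ := integral_erfc_sqrt hac h0 hζ
  obtain ⟨hint', hval'⟩ := integral_pdf_mul_Ioi h0 (hint.const_mul δ)
  have hH := berFoxHParams_hasValue hβ' hz
  refine ⟨hpdf, hint', by rwa [hH.foxH_eq], ?_⟩
  rw [hH.foxH_eq, ← Complex.ofReal_mul]
  congr 1
  have hF : ∀ u ∈ Set.Ioi (0 : ℝ),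
      u ^ (-(1 / 2) : ℝ) * Real.exp (-u) * cdf (P.map (scSNR ρ h)) (u / ζ) =
      u ^ (-(1 / 2) : ℝ) * Real.exp (-u) * ∏ l, (ζ * ρ * α l) ^ (-β l) * u ^ β l /
        (1 + (ζ * ρ * α l) ^ (-β l) * u ^ β l) := fun u hu => by
    have hu : 0 < u := hu
    rw [hcdf]
    congr 1
    refine Finset.prod_congr rfl fun l _ => ?_
    have hl : 0 < ζ * ρ * α l := by rw [mul_assoc]; exact mul_pos hζ (ha l)
    -- The arguments of the H-function arise here: the scales ζ and ρα_l combine into z_l.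
    have e : (max (u / ζ) 0 / (ρ * α l)) ^ β l = (ζ * ρ * α l) ^ (-β l) * u ^ β l := by
      rw [max_eq_left (by positivity), div_div, ← mul_assoc, Real.div_rpow hu.le hl.le,
        Real.rpow_neg hl.le, div_eq_inv_mul]
    rw [logLogisticCDF_eq (ha l) (hβ' l), e]
  rw [averageBER, ← setIntegral_congr_fun measurableSet_Ioi hF]
  unfold berIntegrand
  rw [hval', integral_const_mul, hval]
  ring
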